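/- Let $(N(t))_{t\ge 0}$ be a counting process, i.e. an $\mathbb N$-valued process with nondecreasing right-continuous paths, and let $M$ be a real random variable. Suppose that, conditionally on $M$, $N$ is a simple, time homogeneous, stable and conservative Markov counting process with rate function $n\mapsto\Lambda(n)=\lambda(n,M)$. This means that for almost every $m$ there is a transition function $p^m_h(i,j)$ on $\mathbb N$, measurable in $m$ (nonnegative, $\sum_j p^m_h(i,j)=1$, $p^m_0(i,j)=1_{\{i=j\}}$, Chapman--Kolmogorov, $p^m_h(i,j)=0$ for $j<i$), for which the limits $q(n,k,m)=\lim_{h\downarrow0}h^{-1}p^m_h(n,n+k)$, $k\ge1$, and $\lambda(n,m)=\lim_{h\downarrow0}h^{-1}(1-p^m_h(n,n))$ exist and are finite, $\lambda(n,m)=\sum_{k\ge1}q(n,k,m)$, $q(n,k,m)=0$ for $k\ge2$, $\lambda(n,\cdot)$ is measurable, and $P\big(N(t+h)=j\mid M,\,N(s):s\le t\big)=p^M_h(N(t),j)$ almost surely for all $t,h\ge0$ and $j\in\mathbb N$. Fix $t\ge0$ and $n\in\mathbb N$ with $P(N(t)=n)>0$. For $\bar h>0$ put $\bar\Lambda(t)=\sup_{t\le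 s\le t+\bar h}\Lambda(N(s))$, and write $\Delta N(t)=N(t+h)-N(t)$. 1. Suppose (P1) at $(t,n)$: $E[\bar\Lambda(t)\mid N(t)=n]<\infty$ for some $\bar h>0$. Then $E[\Lambda(n)\mid N(t)=n]<\infty$, $E[\Delta N(t)\mid N(t)=n]<\infty$ for all small $h>0$, and the infinitesimal mean equals the average infinitesimal rate: $$\lim_{h\downarrow0}h^{-1}E[\Delta N(t)\mid N(t)=n]=E[\Lambda(n)\mid N(t)=n].$$ 2. Suppose (P2) at $(t,n)$: for some $\bar h>0$, $\bar\Lambda(t)$ has finite mean and finite variance conditionally on $N(t)=n$. Then $E[(\Delta N(t))^2\mid N(t)=n]<\infty$ for all small $h>0$, and the infinitesimal variance also equals the average infinitesimal rate: $$\lim_{h\downarrow0}h^{-1}V[\Delta N(t)\mid N(t)=n]=E[\Lambda(n)\mid N(t)=n].$$ Hence $N$ is infinitesimally equi-dispersed at $(t,n)$: the infinitesimal mean and variance exist and either their ratio (variance over mean) is $1$ or both are $0$. 3. In particular, let $N$ be a mixed Poisson process, i.e. $q(n,1,m)=m$ for all $n$ and almost every $m$, with $E[M]<\infty$. Then for all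 $t\ge 0$ and $n$ with $P(N(t)=n)>0$ the infinitesimal mean at $(t,n)$ is $E[M\mid N(t)=n]$; and if $t>0$ or $E[M^2]<\infty$, then the infinitesimal variance at $(t,n)$ is $E[M\mid N(t)=n]$ too and $N$ is infinitesimally equi-dispersed at $(t,n)$. -/

import Mathlib

open MeasureTheory ProbabilityTheory Filter Topology
open scoped NNReal ENNReal

/-- `p` is the transition function (`p h i j` is the probability of going from `i` to `j` in time
`h`) of a time homogeneous, stable and conservative Markov counting process on `ℕ`, with
infinitesimal probabilities `q n k` (jump of size `k ≥ 1` from state `n`) and rate function `lam`.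
Stability is the fact that `lam` is real-valued. -/
structure IsMCPTransition (p : ℝ≥0 → ℕ → ℕ → ℝ) (q : ℕ → ℕ → ℝ) (lam : ℕ → ℝ) : Prop where
  nonneg : ∀ h i j, 0 ≤ p h i j
  hasSum_one : ∀ h i, HasSum (fun j => p h i j) 1
  zero : ∀ i j, p 0 i j = if i = j then 1 else 0
  chapman_kolmogorov : ∀ h h' i j, HasSum (fun l => p h i l * p h' l j) (p (h + h') i j)
  counting : ∀ h i j, j < i → p h i j = 0
  infinitesimal_prob : ∀ n k, 1 ≤ k →
    Tendsto (fun h : ℝ≥0 => p h n (n + k) / (h : ℝ)) (𝓝[>] 0) (𝓝 (q n k))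
  rate : ∀ n, Tendsto (fun h : ℝ≥0 => (1 - p h n n) / (h : ℝ)) (𝓝[>] 0) (𝓝 (lam n))
  conservative : ∀ n, HasSum (fun k => q n (k + 1)) (lam n)

/-- Infinitesimal probabilities of a simple process: no jumps of size two or more. -/
def IsSimpleJumps (q : ℕ → ℕ → ℝ) : Prop := ∀ n k, 2 ≤ k → q n k = 0

/-- Counting process: `ℕ`-valued random variables with nondecreasing, right-continuous paths. -/
structure IsCountingProcess {Ω : Type*} [MeasurableSpace Ω] (N : ℝ≥0 → Ω → ℕ) : Prop where
  measurable : ∀ t, Measurable (N t)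
  monotone : ∀ ω, Monotone fun t => N t ω
  rightCts : ∀ ω t, ContinuousWithinAt (fun s => N s ω) (Set.Ici t) t

/-- The information in `M` and in the history of `N` up to time `t`. -/
abbrev mixedHistory {Ω : Type*} (N : ℝ≥0 → Ω → ℕ) (M : Ω → ℝ) (t : ℝ≥0) : MeasurableSpace Ω :=
  MeasurableSpace.comap M inferInstance ⊔
    ⨆ s : Set.Iic t, MeasurableSpace.comap (N s) inferInstance

/-- Conditionally on the random variable `M`, the process `N` is a simple, time homogeneous, stable
and conservative Markov counting process: given `M = m`, its transition function is `p m`, its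
infinitesimal probabilities are `q m` and its rate function is `fun n => lam n m`. -/
structure IsMixedSimpleMCP {Ω : Type*} [MeasurableSpace Ω] (μ : Measure Ω)
    (N : ℝ≥0 → Ω → ℕ) (M : Ω → ℝ) (p : ℝ → ℝ≥0 → ℕ → ℕ → ℝ) (q : ℝ → ℕ → ℕ → ℝ)
    (lam : ℕ → ℝ → ℝ) : Prop where
  countingProcess : IsCountingProcess N
  measurable_mixing : Measurable M
  measurable_transition : ∀ h i j, Measurable fun m => p m h i j
  measurable_rate : ∀ n, Measurable (lam n)
  transition : ∀ᵐ m ∂(μ.map M), IsMCPTransition (p m) (q m) (fun n => lam n m)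
  simple : ∀ᵐ m ∂(μ.map M), IsSimpleJumps (q m)
  markov : ∀ (t h : ℝ≥0) (j : ℕ),
    μ[(N (t + h) ⁻¹' {j}).indicator (fun _ => (1 : ℝ)) | mixedHistory N M t]
      =ᵐ[μ] fun ω => p (M ω) h (N t ω) j

/-- The increment `N (t + h) - N t`, as a real number. -/
def increment {Ω : Type*} (N : ℝ≥0 → Ω → ℕ) (t h : ℝ≥0) (ω : Ω) : ℝ :=
  (N (t + h) ω : ℝ) - (N t ω : ℝ)

/-- The stochastic bound `sup_{t ≤ s ≤ t + hbar} lam (N s) M` of the rate. For a counting process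
this is the supremum of a finite set. -/
noncomputable def rateBound {Ω : Type*} (N : ℝ≥0 → Ω → ℕ) (M : Ω → ℝ) (lam : ℕ → ℝ → ℝ)
    (t hbar : ℝ≥0) (ω : Ω) : ℝ :=
  ⨆ s : Set.Icc t (t + hbar), lam (N s ω) (M ω)

/-- Property P1 at `(t, n)`: given `N t = n`, the rate bound has finite mean for some window. -/
def PropertyP1 {Ω : Type*} [MeasurableSpace Ω] (μ : Measure Ω) (N : ℝ≥0 → Ω → ℕ) (M : Ω → ℝ)
    (lam : ℕ → ℝ → ℝ) (t : ℝ≥0) (n : ℕ) : Prop :=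
  ∃ hbar : ℝ≥0, 0 < hbar ∧ Integrable (rateBound N M lam t hbar) (μ[|N t ⁻¹' {n}])

/-- Property P2 at `(t, n)`: given `N t = n`, the rate bound has finite variance for some
window. -/
def PropertyP2 {Ω : Type*} [MeasurableSpace Ω] (μ : Measure Ω) (N : ℝ≥0 → Ω → ℕ) (M : Ω → ℝ)
    (lam : ℕ → ℝ → ℝ) (t : ℝ≥0) (n : ℕ) : Prop :=
  ∃ hbar : ℝ≥0, 0 < hbar ∧ Integrable (rateBound N M lam t hbar) (μ[|N t ⁻¹' {n}]) ∧
    evariance (rateBound N M lam t hbar) (μ[|N t ⁻¹' {n}]) < ∞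

/-- `a` is the infinitesimal mean `lim_{h ↓ 0} E[N (t + h) - N t | N t = n] / h`, the means being
finite for small `h`. -/
def HasInfinitesimalMean {Ω : Type*} [MeasurableSpace Ω] (μ : Measure Ω) (N : ℝ≥0 → Ω → ℕ)
    (t : ℝ≥0) (n : ℕ) (a : ℝ) : Prop :=
  (∀ᶠ h in 𝓝[>] (0 : ℝ≥0), Integrable (increment N t h) (μ[|N t ⁻¹' {n}])) ∧
  Tendsto (fun h : ℝ≥0 => (∫ ω, increment N t h ω ∂(μ[|N t ⁻¹' {n}])) / (h : ℝ))
    (𝓝[>] 0) (𝓝 a)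

/-- `v` is the infinitesimal variance `lim_{h ↓ 0} V[N (t + h) - N t | N t = n] / h`, the second
moments being finite for small `h`. -/
def HasInfinitesimalVariance {Ω : Type*} [MeasurableSpace Ω] (μ : Measure Ω) (N : ℝ≥0 → Ω → ℕ)
    (t : ℝ≥0) (n : ℕ) (v : ℝ) : Prop :=
  (∀ᶠ h in 𝓝[>] (0 : ℝ≥0), MemLp (increment N t h) 2 (μ[|N t ⁻¹' {n}])) ∧
  Tendsto (fun h : ℝ≥0 => variance (increment N t h) (μ[|N t ⁻¹' {n}]) / (h : ℝ))
    (𝓝[>] 0) (𝓝 v)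

/-- Infinitesimal equi-dispersion at `(t, n)`: the infinitesimal mean `a` and variance `v` exist
and the dispersion index `v / a` is one; where the index is `0 / 0`, both of them vanish. -/
def IsInfinitesimallyEquidispersedAt {Ω : Type*} [MeasurableSpace Ω] (μ : Measure Ω)
    (N : ℝ≥0 → Ω → ℕ) (t : ℝ≥0) (n : ℕ) : Prop :=
  ∃ a v : ℝ, HasInfinitesimalMean μ N t n a ∧ HasInfinitesimalVariance μ N t n v ∧
    (v / a = 1 ∨ (a = 0 ∧ v = 0))

/-- The average infinitesimal rate `E[lam n M | N t = n]`. -/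
noncomputable def averageRate {Ω : Type*} [MeasurableSpace Ω] (μ : Measure Ω)
    (N : ℝ≥0 → Ω → ℕ) (M : Ω → ℝ) (lam : ℕ → ℝ → ℝ) (t : ℝ≥0) (n : ℕ) : ℝ :=
  ∫ ω, lam n (M ω) ∂(μ[|N t ⁻¹' {n}])

/-! Fix `m`. Because a counting process never decreases, Chapman--Kolmogorov for the event "state at
most `j`" involves only the finitely many states `l ≤ j`, so limits may be taken term by term with
no uniform bound on the rates. Jumps being simple, the level `j` can be passed only from `j` itself,
to first order in time. Hence `transitionCDF` has right derivative `-lam j * p h i j`, and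
integrating it gives the probability of passing `j` as an integrated flux (`integral_flux`).

Averaging over `M`, the Markov property turns `p` into the indicator that the process sits in `j`
(`cond_state_gt`). Summing over levels with weights `w k` gives a Dynkin formula
(`lintegral_sum_weight`): the conditional mean of `∑ k < ΔN, w k` is that of the time integral of
`w(ΔN(s)) Λ(N(t+s))`. All terms lie in `ℝ≥0∞`, so it holds before any moment is known to be finite.

Right-continuous integer paths stay at `n` for a positive time, so the time average of the integrand
tends to `w 0 * Λ(n)`, and dominated convergence gives the limit of the means. The weight `1` yields
the mean, with `rateBound` dominating; the weight `2k + 1` yields the second moment, once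
`lintegral_sq_increment_le` supplies an integrable bound. The squared mean is `O(h²)`, so it does
not affect the variance limit.

For a mixed Poisson process `rateBound` is `M` almost surely. When `t > 0`, being in state `n` at
time `t` forces `M` to have a second moment, since `m² p_t(i,n)` is bounded in `m`. -/

/-- The distribution function `∑ l ≤ j, p h i l` of the state after time `h`. -/
def transitionCDF (p : ℝ≥0 → ℕ → ℕ → ℝ) (i j : ℕ) (h : ℝ≥0) : ℝ :=
  ∑ l ∈ Finset.range (j + 1), p h i l

/-! ### Forward equation for a single transition function. -/

namespace IsMCPTransition

variable {p : ℝ≥0 → ℕ → ℕ → ℝ} {q : ℕ → ℕ → ℝ} {lam : ℕ → ℝ}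

theorem le_one (hp : IsMCPTransition p q lam) (h : ℝ≥0) (i j : ℕ) : p h i j ≤ 1 :=
  le_hasSum (hp.hasSum_one h i) j fun k _ => hp.nonneg h i k

theorem rate_nonneg (hp : IsMCPTransition p q lam) (n : ℕ) : 0 ≤ lam n :=
  ge_of_tendsto' (hp.rate n) fun h => div_nonneg (sub_nonneg.2 (hp.le_one h n n)) h.2

theorem jump_one_eq_rate (hp : IsMCPTransition p q lam) (hq : IsSimpleJumps q) (n : ℕ) :
    q n 1 = lam n := by
  refine HasSum.unique ?_ (hp.conservative n)
  exact hasSum_single 0 fun k hk => hq n (k + 1) (by omega)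

theorem chapman_kolmogorov_sum (hp : IsMCPTransition p q lam) (h h' : ℝ≥0) (i : ℕ) {j J : ℕ}
    (hj : j ≤ J) : p (h + h') i j = ∑ l ∈ Finset.range (J + 1), p h i l * p h' l j := by
  refine (hp.chapman_kolmogorov h h' i j).unique (hasSum_sum_of_ne_finset_zero fun l hl => ?_)
  rw [Finset.mem_range, not_lt] at hl
  rw [hp.counting h' l j (by omega), mul_zero]

theorem transitionCDF_add (hp : IsMCPTransition p q lam) (i j : ℕ) (h h' : ℝ≥0) :
    transitionCDF p i j (h + h') =
      ∑ l ∈ Finset.range (j + 1), p h i l * transitionCDF p l j h' := by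
  simp only [transitionCDF, Finset.mul_sum]
  rw [Finset.sum_comm]
  refine Finset.sum_congr rfl fun k hk => ?_
  exact hp.chapman_kolmogorov_sum h h' i (Nat.lt_succ_iff.1 (Finset.mem_range.1 hk))

theorem transitionCDF_zero (hp : IsMCPTransition p q lam) {i j : ℕ} (hij : i ≤ j) :
    transitionCDF p i j 0 = 1 := by
  simp only [transitionCDF, hp.zero, Finset.sum_ite_eq, Finset.mem_range]
  rw [if_pos (by omega)]

theorem transitionCDF_add_sub (hp : IsMCPTransition p q lam) (i j : ℕ) (h h' : ℝ≥0) :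
    transitionCDF p i j (h + h') - transitionCDF p i j h =
      ∑ l ∈ Finset.range (j + 1), p h i l * (transitionCDF p l j h' - 1) := by
  rw [hp.transitionCDF_add]
  simp only [transitionCDF, mul_sub, mul_one, Finset.sum_sub_distrib]

/-- For `i < j`, passing `j` at once would need a jump of size at least two; simplicity and
conservativity give `q i 1 = lam i`, so the gain to `i + 1` cancels the loss from `i`. For `i = j`
only the loss remains. -/
theorem tendsto_transitionCDF_sub_one_div (hp : IsMCPTransition p q lam) (hq : IsSimpleJumps q)
    {i j : ℕ} (hij : i ≤ j) :
    Tendsto (fun h : ℝ≥0 => (transitionCDF p i j h - 1) / (h : ℝ)) (𝓝[>] 0)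
      (𝓝 (if i = j then -lam j else 0)) := by
  have key : ∀ h : ℝ≥0, (transitionCDF p i j h - 1) / (h : ℝ) =
      ∑ k ∈ Finset.range (j - i), p h i (i + (k + 1)) / (h : ℝ) - (1 - p h i i) / (h : ℝ) := by
    intro h
    have h1 : transitionCDF p i j h =
        ∑ k ∈ Finset.range (j - i), p h i (i + (k + 1)) + p h i i := by
      rw [transitionCDF, show j + 1 = i + (j - i + 1) by omega, Finset.sum_range_add,
        Finset.sum_eq_zero fun l hl => hp.counting h i l (Finset.mem_range.1 hl), zero_add,
        Finset.sum_range_succ']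
      rfl
    rw [h1, ← Finset.sum_div]
    ring
  simp only [key]
  have lim := (tendsto_finsetSum (Finset.range (j - i)) fun k _ =>
    hp.infinitesimal_prob i (k + 1) (by omega)).sub (hp.rate i)
  convert lim using 2
  split_ifs with h
  · subst h; simp
  · obtain ⟨d, rfl⟩ : ∃ d, j = i + (d + 1) := ⟨j - i - 1, by omega⟩
    rw [show i + (d + 1) - i = d + 1 by omega, Finset.sum_range_succ',
      Finset.sum_eq_zero fun k _ => hq i (k + 1 + 1) (by omega), zero_add,
      hp.jump_one_eq_rate hq, sub_self]

theorem tendsto_transitionCDF_sub_one (hp : IsMCPTransition p q lam) (hq : IsSimpleJumps q)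
    {i j : ℕ} (hij : i ≤ j) :
    Tendsto (fun h : ℝ≥0 => transitionCDF p i j h - 1) (𝓝 0) (𝓝 0) := by
  have h0 : Tendsto (fun h : ℝ≥0 => (h : ℝ)) (𝓝[>] 0) (𝓝 0) :=
    (NNReal.continuous_coe.tendsto' 0 0 rfl).mono_left nhdsWithin_le_nhds
  have h1 := (hp.tendsto_transitionCDF_sub_one_div hq hij).mul h0
  rw [mul_zero] at h1
  have h2 : Tendsto (fun h : ℝ≥0 => transitionCDF p i j h - 1) (𝓝[>] 0) (𝓝 0) := by
    refine h1.congr' ?_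
    filter_upwards [self_mem_nhdsWithin] with h hh
    exact div_mul_cancel₀ _ (NNReal.coe_pos.2 hh).ne'
  -- In `ℝ≥0` a neighbourhood of `0` is a right neighbourhood together with the point `0`, where the
  -- value is exact.
  have h3 : (𝓝 (0 : ℝ≥0)) = 𝓝[>] 0 ⊔ pure 0 := by
    rw [← nhdsWithin_univ, sup_comm, ← nhdsWithin_singleton, ← nhdsWithin_union]
    congr 1
    ext x
    simp
  rw [h3]
  refine h2.sup (tendsto_pure_left.2 fun s hs => ?_)
  rw [hp.transitionCDF_zero hij, sub_self]
  exact mem_of_mem_nhds hs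

/-- The modulus `r` depends only on the length of the time step, not on its starting point, so
smallness at time `0` gives continuity from both sides everywhere. -/
theorem continuous_transitionCDF (hp : IsMCPTransition p q lam) (hq : IsSimpleJumps q)
    (i j : ℕ) : Continuous (transitionCDF p i j) := by
  set r : ℝ≥0 → ℝ := fun d => ∑ l ∈ Finset.range (j + 1), |transitionCDF p l j d - 1| with hr
  have hr0 : Tendsto r (𝓝 0) (𝓝 0) := by
    have := tendsto_finsetSum (Finset.range (j + 1)) fun l hl =>
      (hp.tendsto_transitionCDF_sub_one hq (Nat.lt_succ_iff.1 (Finset.mem_range.1 hl))).abs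
    simpa using this
  have key : ∀ a b : ℝ≥0, a ≤ b →
      |transitionCDF p i j b - transitionCDF p i j a| ≤ r (nndist b a) := by
    intro a b hab
    have hd : nndist b a = b - a := by
      rw [NNReal.nndist_eq, tsub_eq_zero_of_le hab, max_eq_left (zero_le)]
    rw [hd]
    conv_lhs => rw [← add_tsub_cancel_of_le hab]
    rw [hp.transitionCDF_add_sub]
    refine (Finset.abs_sum_le_sum_abs _ _).trans (Finset.sum_le_sum fun l _ => ?_)
    rw [abs_mul, abs_of_nonneg (hp.nonneg _ _ _)]
    exact mul_le_of_le_one_left (abs_nonneg _) (hp.le_one _ _ _)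
  refine continuous_iff_continuousAt.2 fun a => ?_
  rw [ContinuousAt, tendsto_iff_dist_tendsto_zero]
  have hn : Tendsto (fun b => nndist b a) (𝓝 a) (𝓝 0) := by
    have : Continuous fun b : ℝ≥0 => nndist b a := by fun_prop
    exact this.tendsto' _ _ (nndist_self a)
  refine squeeze_zero (fun _ => dist_nonneg) (fun b => ?_) (hr0.comp hn)
  rw [Real.dist_eq]
  rcases le_total a b with hab | hab
  · exact key a b hab
  · rw [abs_sub_comm, Function.comp_apply, nndist_comm]
    exact key b a hab

theorem continuous_apply (hp : IsMCPTransition p q lam) (hq : IsSimpleJumps q) (i j : ℕ) :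
    Continuous fun h => p h i j := by
  cases j with
  | zero => exact (hp.continuous_transitionCDF hq i 0).congr fun x => by simp [transitionCDF]
  | succ j =>
    have h := (hp.continuous_transitionCDF hq i (j + 1)).sub (hp.continuous_transitionCDF hq i j)
    refine h.congr fun x => ?_
    change transitionCDF p i (j + 1) x - transitionCDF p i j x = p x i (j + 1)
    simp only [transitionCDF, Finset.sum_range_succ _ (j + 1), add_sub_cancel_left]

/-- Forward equation: in the finite sum over `l ≤ j` from Chapman--Kolmogorov, only `l = j` has a
nonzero derivative at time `0`. A right derivative suffices for the fundamental theorem of calculus,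
given continuity. -/
theorem hasDerivWithinAt_transitionCDF (hp : IsMCPTransition p q lam) (hq : IsSimpleJumps q)
    (i j : ℕ) {x : ℝ} (hx : 0 ≤ x) :
    HasDerivWithinAt (fun s : ℝ => transitionCDF p i j s.toNNReal)
      (-(lam j * p x.toNNReal i j)) (Set.Ioi x) x := by
  rw [hasDerivWithinAt_iff_tendsto_slope' (by simp)]
  have h1 : Tendsto (fun y : ℝ => (y - x).toNNReal) (𝓝[>] x) (𝓝[>] 0) := by
    refine tendsto_nhdsWithin_iff.2 ⟨?_, ?_⟩
    · have : Continuous fun y : ℝ => (y - x).toNNReal := by fun_prop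
      exact (this.tendsto' x 0 (by simp)).mono_left nhdsWithin_le_nhds
    · filter_upwards [self_mem_nhdsWithin] with y hy
      simpa using hy
  have h2 : Tendsto (fun h : ℝ≥0 => ∑ l ∈ Finset.range (j + 1),
      p x.toNNReal i l * ((transitionCDF p l j h - 1) / (h : ℝ))) (𝓝[>] 0)
      (𝓝 (-(lam j * p x.toNNReal i j))) := by
    have := tendsto_finsetSum (Finset.range (j + 1)) fun l hl =>
      (hp.tendsto_transitionCDF_sub_one_div hq
        (Nat.lt_succ_iff.1 (Finset.mem_range.1 hl))).const_mul (p x.toNNReal i l)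
    convert this using 2
    simp [mul_comm]
  refine (h2.comp h1).congr' ?_
  filter_upwards [self_mem_nhdsWithin] with y hy
  have hy' : 0 ≤ y - x := sub_nonneg.2 (le_of_lt hy)
  have hsum : y.toNNReal = x.toNNReal + (y - x).toNNReal := by
    rw [← Real.toNNReal_add hx hy', add_sub_cancel]
  rw [slope_def_field, hsum, hp.transitionCDF_add_sub, Function.comp_apply, Finset.sum_div,
    Real.coe_toNNReal _ hy']
  exact Finset.sum_congr rfl fun l _ => (mul_div_assoc _ _ _).symm

/-- The survival function is the integrated flux out of the state `j`. -/
theorem integral_flux (hp : IsMCPTransition p q lam) (hq : IsSimpleJumps q) {i j : ℕ}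
    (hij : i ≤ j) (h : ℝ≥0) :
    ∫ s in (0 : ℝ)..h, lam j * p s.toNNReal i j = 1 - transitionCDF p i j h := by
  have hc : Continuous fun s : ℝ => lam j * p s.toNNReal i j :=
    continuous_const.mul ((hp.continuous_apply hq i j).comp continuous_real_toNNReal)
  have := intervalIntegral.integral_eq_sub_of_hasDeriv_right (a := 0) (b := (h : ℝ))
    (((hp.continuous_transitionCDF hq i j).comp continuous_real_toNNReal).continuousOn)
    (fun x hx => hp.hasDerivWithinAt_transitionCDF hq i j
      (le_of_lt (by simpa using hx.1)))
    (hc.neg.intervalIntegrable _ _)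
  rw [intervalIntegral.integral_neg] at this
  simp only [Function.comp_apply, Real.toNNReal_coe, Real.toNNReal_zero,
    hp.transitionCDF_zero hij] at this
  linarith

theorem one_sub_transitionCDF (hp : IsMCPTransition p q lam) (hq : IsSimpleJumps q) {i j : ℕ}
    (hij : i ≤ j) (h : ℝ≥0) :
    ENNReal.ofReal (1 - transitionCDF p i j h) =
      ∫⁻ s in Set.Ioc (0 : ℝ) h, ENNReal.ofReal (lam j) * ENNReal.ofReal (p s.toNNReal i j) := by
  have hc : Continuous fun s : ℝ => lam j * p s.toNNReal i j :=
    continuous_const.mul ((hp.continuous_apply hq i j).comp continuous_real_toNNReal)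
  rw [← hp.integral_flux hq hij, intervalIntegral.integral_of_le h.coe_nonneg,
    ofReal_integral_eq_lintegral_ofReal (hc.integrableOn_Ioc)
      (ae_of_all _ fun s => mul_nonneg (hp.rate_nonneg j) (hp.nonneg _ _ _))]
  simp only [ENNReal.ofReal_mul (hp.rate_nonneg j)]

end IsMCPTransition

/-! ### Path regularity of counting processes. -/

theorem IsCountingProcess.eventually_eq {Ω : Type*} [MeasurableSpace Ω] {N : ℝ≥0 → Ω → ℕ}
    (hN : IsCountingProcess N) (ω : Ω) (t : ℝ≥0) : ∀ᶠ s in 𝓝[≥] t, N s ω = N t ω := by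
  have h := hN.rightCts ω t
  rw [ContinuousWithinAt, nhds_discrete, tendsto_pure] at h
  exact h

/-- Monotonicity and right continuity reduce `k ≤ N s` to countably many times: it holds exactly
when every `r` of a dense set satisfies `r ≤ s` or `k ≤ N r`. -/
theorem IsCountingProcess.measurable_uncurry {Ω : Type*} [MeasurableSpace Ω] {N : ℝ≥0 → Ω → ℕ}
    (hN : IsCountingProcess N) : Measurable fun x : Ω × ℝ≥0 => N x.2 x.1 := by
  refine measurable_of_Ici fun k => ?_
  obtain ⟨D, hDc, hDd⟩ := TopologicalSpace.exists_countable_dense ℝ≥0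
  have key : (fun x : Ω × ℝ≥0 => N x.2 x.1) ⁻¹' Set.Ici k =
      ⋂ r ∈ D, (Prod.snd ⁻¹' Set.Ici r ∪ Prod.fst ⁻¹' (N r ⁻¹' Set.Ici k)) := by
    ext ⟨ω, s⟩
    simp only [Set.mem_preimage, Set.mem_Ici, Set.mem_iInter, Set.mem_union]
    refine ⟨fun h r _ => (le_total r s).imp id fun hr => h.trans (hN.monotone ω hr), fun h => ?_⟩
    have hs : ∀ᶠ r in 𝓝[>] s, N r ω = N s ω := (hN.eventually_eq ω s).filter_mono
      (nhdsWithin_mono s Set.Ioi_subset_Ici_self)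
    obtain ⟨u, hu, hsub⟩ := mem_nhdsGT_iff_exists_Ioo_subset.1 hs
    obtain ⟨r, hrD, hr⟩ := hDd.exists_between hu
    have := h r hrD
    rw [hsub hr] at this
    exact this.resolve_left (not_le.2 hr.1)
  rw [key]
  exact MeasurableSet.biInter hDc fun r _ => (measurable_snd measurableSet_Ici).union
    (measurable_fst ((hN.measurable r) measurableSet_Ici))

/-! ### Averaging over the mixing variable and Dynkin's formula. -/

namespace IsMixedSimpleMCP

variable {Ω : Type*} [MeasurableSpace Ω] {μ : Measure Ω}
  {N : ℝ≥0 → Ω → ℕ} {M : Ω → ℝ} {p : ℝ → ℝ≥0 → ℕ → ℕ → ℝ} {q : ℝ → ℕ → ℕ → ℝ}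
  {lam : ℕ → ℝ → ℝ}

theorem mixedHistory_le (hN : IsMixedSimpleMCP μ N M p q lam) (t : ℝ≥0) :
    mixedHistory N M t ≤ ‹MeasurableSpace Ω› :=
  sup_le hN.measurable_mixing.comap_le
    (iSup_le fun s => (hN.countingProcess.measurable s).comap_le)

theorem ae_transition (hN : IsMixedSimpleMCP μ N M p q lam) :
    ∀ᵐ ω ∂μ, IsMCPTransition (p (M ω)) (q (M ω)) (fun n => lam n (M ω)) ∧
      IsSimpleJumps (q (M ω)) :=
  ae_of_ae_map hN.measurable_mixing.aemeasurable (hN.transition.and hN.simple)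

theorem measurableSet_state (hN : IsMixedSimpleMCP μ N M p q lam) (t : ℝ≥0) (n : ℕ) :
    MeasurableSet (N t ⁻¹' {n}) :=
  hN.countingProcess.measurable t (measurableSet_singleton n)

/-- The joint law of `M` and of the state after time `h`, on the event `N t = n`. -/
theorem map_mixing_restrict [IsProbabilityMeasure μ] (hN : IsMixedSimpleMCP μ N M p q lam)
    (t h : ℝ≥0) (n j : ℕ) :
    (μ.restrict (N t ⁻¹' {n} ∩ N (t + h) ⁻¹' {j})).map M =
      ((μ.restrict (N t ⁻¹' {n})).map M).withDensity fun m => ENNReal.ofReal (p m h n j) := by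
  have hM := hN.measurable_mixing
  have hA := hN.measurableSet_state t n
  have hB := hN.measurableSet_state (t + h) j
  have hpm : Measurable fun m => ENNReal.ofReal (p m h n j) :=
    (hN.measurable_transition h n j).ennreal_ofReal
  ext S hS
  have hMS : MeasurableSet (M ⁻¹' S) := hM hS
  -- The Markov property may be integrated over this event because it belongs to the history.
  have hC : MeasurableSet[mixedHistory N M t] (M ⁻¹' S ∩ N t ⁻¹' {n}) := by
    refine MeasurableSet.inter ?_ ?_
    · exact (le_sup_left : _ ≤ mixedHistory N M t) _ ⟨S, hS, rfl⟩
    · refine (le_sup_right : _ ≤ mixedHistory N M t) _ ?_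
      exact (le_iSup (fun s : Set.Iic t => MeasurableSpace.comap (N s) inferInstance)
        ⟨t, Set.mem_Iic.2 le_rfl⟩) _ ⟨{n}, measurableSet_singleton n, rfl⟩
  have hint : Integrable ((N (t + h) ⁻¹' {j}).indicator fun _ => (1 : ℝ)) μ :=
    (integrable_const 1).indicator hB
  have h1 := setIntegral_condExp (hN.mixedHistory_le t) hint hC
  have hae := hN.markov t h j
  rw [setIntegral_congr_ae (g := fun ω => p (M ω) h n j) (hMS.inter hA)
    (hae.mono fun ω hω hmem => by
      rw [hω]; simp only [show N t ω = n from hmem.2]), setIntegral_indicator hB, setIntegral_const,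
      smul_eq_mul, mul_one] at h1
  have hpi : IntegrableOn (fun ω => p (M ω) h n j) (M ⁻¹' S ∩ N t ⁻¹' {n}) μ := by
    refine (integrable_condExp (m := mixedHistory N M t)
      (f := (N (t + h) ⁻¹' {j}).indicator fun _ => (1 : ℝ))).integrableOn.congr ?_
    refine (ae_restrict_iff' (hMS.inter hA)).2 (hae.mono fun ω hω hmem => ?_)
    rw [hω]
    simp only [show N t ω = n from hmem.2]
  have hp0 : 0 ≤ᵐ[μ.restrict (M ⁻¹' S ∩ N t ⁻¹' {n})] fun ω => p (M ω) h n j :=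
    ae_restrict_of_ae (hN.ae_transition.mono fun ω hω => hω.1.nonneg h n j)
  rw [Measure.map_apply hM hS, Measure.restrict_apply hMS, withDensity_apply _ hS,
    setLIntegral_map hS hpm hM, Measure.restrict_restrict hMS,
    ← ofReal_integral_eq_lintegral_ofReal hpi hp0, h1, ofReal_measureReal, Set.inter_assoc]

theorem setLIntegral_state [IsProbabilityMeasure μ] (hN : IsMixedSimpleMCP μ N M p q lam)
    (t h : ℝ≥0) (n j : ℕ) {φ : ℝ → ℝ≥0∞} (hφ : Measurable φ) :
    ∫⁻ ω in N t ⁻¹' {n} ∩ N (t + h) ⁻¹' {j}, φ (M ω) ∂μ =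
      ∫⁻ ω in N t ⁻¹' {n}, φ (M ω) * ENNReal.ofReal (p (M ω) h n j) ∂μ := by
  have hM := hN.measurable_mixing
  have hpm : Measurable fun m => ENNReal.ofReal (p m h n j) :=
    (hN.measurable_transition h n j).ennreal_ofReal
  rw [← lintegral_map hφ hM, hN.map_mixing_restrict,
    lintegral_withDensity_eq_lintegral_mul _ hpm hφ, lintegral_map (hpm.mul hφ) hM]
  simp only [Pi.mul_apply, mul_comm]

theorem lintegral_cond_state [IsProbabilityMeasure μ] (hN : IsMixedSimpleMCP μ N M p q lam)
    (t h : ℝ≥0) (n j : ℕ) {φ : ℝ → ℝ≥0∞} (hφ : Measurable φ) :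
    ∫⁻ ω, φ (M ω) * (N (t + h) ⁻¹' {j}).indicator 1 ω ∂μ[|N t ⁻¹' {n}] =
      ∫⁻ ω, φ (M ω) * ENNReal.ofReal (p (M ω) h n j) ∂μ[|N t ⁻¹' {n}] := by
  have hB := hN.measurableSet_state (t + h) j
  rw [ProbabilityTheory.cond, lintegral_smul_measure, lintegral_smul_measure,
    ← hN.setLIntegral_state t h n j hφ, Set.inter_comm, ← Measure.restrict_restrict hB,
    ← lintegral_indicator hB]
  congr 2 with ω
  by_cases hω : ω ∈ N (t + h) ⁻¹' {j} <;> simp [hω]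

theorem ae_cond_transition (hN : IsMixedSimpleMCP μ N M p q lam) (t : ℝ≥0) (n : ℕ) :
    ∀ᵐ ω ∂μ[|N t ⁻¹' {n}], N t ω = n ∧
      IsMCPTransition (p (M ω)) (q (M ω)) (fun n => lam n (M ω)) ∧ IsSimpleJumps (q (M ω)) :=
  (ae_cond_mem (hN.measurableSet_state t n)).and
    (cond_absolutelyContinuous.ae_le hN.ae_transition)

/-- A Carathéodory argument: `p` is measurable in `m` and, for almost every `m`, continuous in time.
The indicator of a measurable set of good `m` removes the exceptions. Tonelli's theorem needs this
joint measurability. -/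
theorem aemeasurable_uncurry_transition (hN : IsMixedSimpleMCP μ N M p q lam) (ν : Measure Ω)
    [SFinite ν] (hν : ν ≪ μ) (κ : Measure ℝ) [SFinite κ] (i j : ℕ) :
    AEMeasurable (fun x : Ω × ℝ => p (M x.1) x.2.toNNReal i j) (ν.prod κ) := by
  obtain ⟨S, hS, hSm, hSsub⟩ := (hN.transition.and hN.simple).exists_measurable_mem
  have h1 : Measurable (Function.uncurry fun (s : ℝ≥0) (m : ℝ) =>
      S.indicator (fun m => p m s i j) m) := by
    refine measurable_uncurry_of_continuous_of_measurable (fun m => ?_)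
      fun s => (hN.measurable_transition s i j).indicator hSm
    by_cases hm : m ∈ S
    · simpa [hm] using (hSsub m hm).1.continuous_apply (hSsub m hm).2 i j
    · simpa [hm] using continuous_const
  refine ⟨fun x => S.indicator (fun m => p m x.2.toNNReal i j) (M x.1),
    h1.comp (((measurable_real_toNNReal.comp measurable_snd)).prodMk
      (hN.measurable_mixing.comp measurable_fst)), ?_⟩
  have h2 : ∀ᵐ ω ∂ν, M ω ∈ S := hν.ae_le (ae_of_ae_map hN.measurable_mixing.aemeasurable hS)
  filter_upwards [Measure.quasiMeasurePreserving_fst.ae h2] with x hx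
  rw [Set.indicator_of_mem hx]

theorem cond_state_le [IsProbabilityMeasure μ] (hN : IsMixedSimpleMCP μ N M p q lam)
    (t h : ℝ≥0) (n j : ℕ) :
    μ[|N t ⁻¹' {n}] (N (t + h) ⁻¹' Set.Iic j) =
      ∫⁻ ω, ENNReal.ofReal (transitionCDF (p (M ω)) n j h) ∂μ[|N t ⁻¹' {n}] := by
  have h1 : N (t + h) ⁻¹' Set.Iic j =
      ⋃ l ∈ Finset.range (j + 1), N (t + h) ⁻¹' {l} := by
    ext ω; simp
  have h2 : ∀ l, μ[|N t ⁻¹' {n}] (N (t + h) ⁻¹' {l}) =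
      ∫⁻ ω, ENNReal.ofReal (p (M ω) h n l) ∂μ[|N t ⁻¹' {n}] := by
    intro l
    have := hN.lintegral_cond_state t h n l (φ := fun _ => 1) measurable_const
    simpa only [one_mul, lintegral_indicator_one (hN.measurableSet_state _ _)] using this
  rw [h1, measure_biUnion_finset (fun a _ b _ hab => ?_) fun l _ => hN.measurableSet_state _ l]
  · simp only [h2]
    rw [← lintegral_finsetSum _ fun l _ => Measurable.ennreal_ofReal
      (f := fun ω => p (M ω) h n l) ((hN.measurable_transition h n l).comp hN.measurable_mixing)]
    refine lintegral_congr_ae ((hN.ae_cond_transition t n).mono fun ω hω => ?_)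
    exact (ENNReal.ofReal_sum_of_nonneg fun l _ => hω.2.1.nonneg h n l).symm
  · exact Disjoint.preimage _ (by simpa using hab)

/-- Probability of passing the state `j`, as an integrated flux. -/
theorem cond_state_gt [IsProbabilityMeasure μ] (hN : IsMixedSimpleMCP μ N M p q lam)
    (t h : ℝ≥0) {n j : ℕ} (hnj : n ≤ j)
    (hA : μ (N t ⁻¹' {n}) ≠ 0) :
    μ[|N t ⁻¹' {n}] (N (t + h) ⁻¹' Set.Ioi j) =
      ∫⁻ ω, (∫⁻ s in Set.Ioc (0 : ℝ) h, ENNReal.ofReal (lam j (M ω)) *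
        (N (t + s.toNNReal) ⁻¹' {j}).indicator 1 ω) ∂μ[|N t ⁻¹' {n}] := by
  set ν := μ[|N t ⁻¹' {n}] with hν
  have : IsProbabilityMeasure ν := cond_isProbabilityMeasure hA
  have hM := hN.measurable_mixing
  have hlam : Measurable fun ω => ENNReal.ofReal (lam j (M ω)) :=
    ((hN.measurable_rate j).comp hM).ennreal_ofReal
  have hcdf : Measurable fun ω => ENNReal.ofReal (transitionCDF (p (M ω)) n j h) :=
    (Finset.measurable_fun_sum _ fun l _ => (hN.measurable_transition h n l).comp hM).ennreal_ofReal
  have hgood := hN.ae_cond_transition t n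
  have h1 : ν (N (t + h) ⁻¹' Set.Ioi j) =
      ∫⁻ ω, ENNReal.ofReal (1 - transitionCDF (p (M ω)) n j h) ∂ν := by
    have hm : MeasurableSet (N (t + h) ⁻¹' Set.Iic j) :=
      hN.countingProcess.measurable _ measurableSet_Iic
    have hc : N (t + h) ⁻¹' Set.Ioi j = (N (t + h) ⁻¹' Set.Iic j)ᶜ := by
      rw [← Set.preimage_compl, Set.compl_Iic]
    have hsum : ∫⁻ ω, ENNReal.ofReal (transitionCDF (p (M ω)) n j h) ∂ν +
        ∫⁻ ω, ENNReal.ofReal (1 - transitionCDF (p (M ω)) n j h) ∂ν = 1 := by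
      rw [← lintegral_add_left hcdf, ← measure_univ (μ := ν), ← lintegral_one]
      refine lintegral_congr_ae (hgood.mono fun ω hω => ?_)
      have h0 : 0 ≤ transitionCDF (p (M ω)) n j h :=
        Finset.sum_nonneg fun l _ => hω.2.1.nonneg h n l
      have h1 : transitionCDF (p (M ω)) n j h ≤ 1 :=
        sum_le_hasSum _ (fun l _ => hω.2.1.nonneg h n l) (hω.2.1.hasSum_one h n)
      simp only
      rw [← ENNReal.ofReal_add h0 (sub_nonneg.2 h1)]
      simp
    rw [hc, prob_compl_eq_one_sub hm, ← hsum, ← hN.cond_state_le]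
    exact ENNReal.add_sub_cancel_left (measure_ne_top _ _)
  have hpm : AEMeasurable (Function.uncurry fun (ω : Ω) (s : ℝ) => ENNReal.ofReal (lam j (M ω)) *
      ENNReal.ofReal (p (M ω) s.toNNReal n j)) (ν.prod (volume.restrict (Set.Ioc (0 : ℝ) h))) :=
    (hlam.comp measurable_fst).aemeasurable.mul
      (hN.aemeasurable_uncurry_transition ν cond_absolutelyContinuous _ n j).ennreal_ofReal
  have hNm : Measurable fun x : Ω × ℝ => N (t + x.2.toNNReal) x.1 :=
    hN.countingProcess.measurable_uncurry.comp
      (measurable_fst.prodMk (measurable_const.add measurable_snd.real_toNNReal))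
  have hIm : Measurable (Function.uncurry fun (ω : Ω) (s : ℝ) => ENNReal.ofReal (lam j (M ω)) *
      (N (t + s.toNNReal) ⁻¹' {j}).indicator (1 : Ω → ℝ≥0∞) ω) := by
    refine (hlam.comp measurable_fst).mul ?_
    have : Measurable ((({j} : Set ℕ).indicator (1 : ℕ → ℝ≥0∞)) ∘
      fun x : Ω × ℝ => N (t + x.2.toNNReal) x.1) := (measurable_of_countable _).comp hNm
    exact this
  rw [h1]
  -- Tonelli is applied twice: the exchange of `p` for the indicator of the state holds only after
  -- averaging over `ω`, at a fixed time `s`.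
  calc ∫⁻ ω, ENNReal.ofReal (1 - transitionCDF (p (M ω)) n j h) ∂ν
      = ∫⁻ ω, (∫⁻ s in Set.Ioc (0 : ℝ) h, ENNReal.ofReal (lam j (M ω)) *
          ENNReal.ofReal (p (M ω) s.toNNReal n j)) ∂ν :=
        lintegral_congr_ae (hgood.mono fun ω hω => hω.2.1.one_sub_transitionCDF hω.2.2 hnj h)
    _ = ∫⁻ s in Set.Ioc (0 : ℝ) h, ∫⁻ ω, ENNReal.ofReal (lam j (M ω)) *
          ENNReal.ofReal (p (M ω) s.toNNReal n j) ∂ν := lintegral_lintegral_swap hpm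
    _ = ∫⁻ s in Set.Ioc (0 : ℝ) h, ∫⁻ ω, ENNReal.ofReal (lam j (M ω)) *
          (N (t + s.toNNReal) ⁻¹' {j}).indicator 1 ω ∂ν :=
        lintegral_congr fun s => (hN.lintegral_cond_state t s.toNNReal n j
          (hN.measurable_rate j).ennreal_ofReal).symm
    _ = _ := (lintegral_lintegral_swap hIm.aemeasurable).symm

/-- Rate of the process at time `t + s`, weighted by a function of the increment since `t`. -/
noncomputable def weightedRate (N : ℝ≥0 → Ω → ℕ) (M : Ω → ℝ) (lam : ℕ → ℝ → ℝ) (t : ℝ≥0) (n : ℕ)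
    (w : ℕ → ℝ≥0∞) (ω : Ω) (s : ℝ) : ℝ≥0∞ :=
  w (N (t + s.toNNReal) ω - n) * ENNReal.ofReal (lam (N (t + s.toNNReal) ω) (M ω))

theorem measurable_weightedRate (hN : IsMixedSimpleMCP μ N M p q lam) (t : ℝ≥0) (n : ℕ)
    (w : ℕ → ℝ≥0∞) : Measurable (Function.uncurry (weightedRate N M lam t n w)) := by
  have hNm : Measurable fun x : Ω × ℝ => N (t + x.2.toNNReal) x.1 :=
    hN.countingProcess.measurable_uncurry.comp
      (measurable_fst.prodMk (measurable_const.add measurable_snd.real_toNNReal))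
  have hlam : Measurable fun x : ℕ × ℝ => lam x.1 x.2 :=
    measurable_from_prod_countable_right hN.measurable_rate
  have h1 : Measurable fun x : Ω × ℝ => w (N (t + x.2.toNNReal) x.1 - n) :=
    (measurable_of_countable fun k => w (k - n)).comp hNm
  exact h1.mul (hlam.comp (hNm.prodMk
    (hN.measurable_mixing.comp measurable_fst))).ennreal_ofReal

/-- Dynkin's formula for functions of the increment. -/
theorem lintegral_sum_weight [IsProbabilityMeasure μ] (hN : IsMixedSimpleMCP μ N M p q lam)
    (t h : ℝ≥0) (n : ℕ)
    (hA : μ (N t ⁻¹' {n}) ≠ 0) (w : ℕ → ℝ≥0∞) :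
    ∫⁻ ω, ∑ k ∈ Finset.range (N (t + h) ω - n), w k ∂μ[|N t ⁻¹' {n}] =
      ∫⁻ ω, (∫⁻ s in Set.Ioc (0 : ℝ) h, weightedRate N M lam t n w ω s) ∂μ[|N t ⁻¹' {n}] := by
  set ν := μ[|N t ⁻¹' {n}] with hν
  have : IsProbabilityMeasure ν := cond_isProbabilityMeasure hA
  have hM := hN.measurable_mixing
  have hNm : Measurable fun x : Ω × ℝ => N (t + x.2.toNNReal) x.1 :=
    hN.countingProcess.measurable_uncurry.comp
      (measurable_fst.prodMk (measurable_const.add measurable_snd.real_toNNReal))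
  have hGm : ∀ k, MeasurableSet (N (t + h) ⁻¹' Set.Ioi (n + k)) := fun k =>
    hN.countingProcess.measurable _ measurableSet_Ioi
  have hIm : ∀ j : ℕ, Measurable (Function.uncurry fun (ω : Ω) (s : ℝ) =>
      ENNReal.ofReal (lam j (M ω)) *
        (N (t + s.toNNReal) ⁻¹' {j}).indicator (1 : Ω → ℝ≥0∞) ω) := by
    intro j
    refine (((hN.measurable_rate j).comp hM).ennreal_ofReal.comp measurable_fst).mul ?_
    have : Measurable ((({j} : Set ℕ).indicator (1 : ℕ → ℝ≥0∞)) ∘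
      fun x : Ω × ℝ => N (t + x.2.toNNReal) x.1) := (measurable_of_countable _).comp hNm
    exact this
  -- Layer-cake form: the weight `w k` is collected exactly when the level `n + k` has been passed.
  have h1 : ∀ ω, ∑ k ∈ Finset.range (N (t + h) ω - n), w k =
      ∑' k, w k * (N (t + h) ⁻¹' Set.Ioi (n + k)).indicator 1 ω := by
    intro ω
    rw [tsum_eq_sum (s := Finset.range (N (t + h) ω - n)) fun k hk => ?_]
    · refine Finset.sum_congr rfl fun k hk => ?_
      have : n + k < N (t + h) ω := by have := Finset.mem_range.1 hk; omega
      simp [this]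
    · have : ¬ n + k < N (t + h) ω := fun h => hk (Finset.mem_range.2 (by omega))
      simp [this]
  -- At each time only the level currently occupied contributes; monotonicity makes the natural
  -- subtraction in `weightedRate` exact.
  have h2 : ∀ᵐ ω ∂ν, ∀ s : ℝ, weightedRate N M lam t n w ω s =
      ∑' k, w k * (ENNReal.ofReal (lam (n + k) (M ω)) *
        (N (t + s.toNNReal) ⁻¹' {n + k}).indicator 1 ω) := by
    filter_upwards [hN.ae_cond_transition t n] with ω hω s
    have hle : n ≤ N (t + s.toNNReal) ω := hω.1 ▸ hN.countingProcess.monotone ω le_self_add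
    obtain ⟨d, hd⟩ := Nat.exists_eq_add_of_le hle
    rw [weightedRate, tsum_eq_single d fun k hk => ?_]
    · simp [hd]
    · simp [hd, hk.symm]
  simp only [h1]
  rw [lintegral_tsum fun k => ((measurable_one.indicator (hGm k)).const_mul _).aemeasurable]
  calc ∑' k, ∫⁻ ω, w k * (N (t + h) ⁻¹' Set.Ioi (n + k)).indicator 1 ω ∂ν
      = ∑' k, ∫⁻ ω, (∫⁻ s in Set.Ioc (0 : ℝ) h, w k * (ENNReal.ofReal (lam (n + k) (M ω)) *
          (N (t + s.toNNReal) ⁻¹' {n + k}).indicator 1 ω)) ∂ν := by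
        refine tsum_congr fun k => ?_
        rw [lintegral_const_mul _ (measurable_one.indicator (hGm k)),
          lintegral_indicator_one (hGm k), hN.cond_state_gt t h (Nat.le_add_right n k) hA,
          ← lintegral_const_mul _ (hIm (n + k)).lintegral_prod_right]
        exact lintegral_congr fun ω =>
          (lintegral_const_mul _ ((hIm (n + k)).comp measurable_prodMk_left)).symm
    _ = ∫⁻ ω, (∫⁻ s in Set.Ioc (0 : ℝ) h, ∑' k, w k * (ENNReal.ofReal (lam (n + k) (M ω)) *
          (N (t + s.toNNReal) ⁻¹' {n + k}).indicator 1 ω)) ∂ν := by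
        rw [← lintegral_tsum fun k =>
          (((hIm (n + k)).const_mul (w k)).lintegral_prod_right).aemeasurable]
        exact lintegral_congr fun ω => (lintegral_tsum fun k =>
          (((hIm (n + k)).const_mul (w k)).comp measurable_prodMk_left).aemeasurable).symm
    _ = _ := lintegral_congr_ae (h2.mono fun ω hω => by simp only [hω])

end IsMixedSimpleMCP

/-! ### The rate bound and the weights of the second moment. -/

theorem IsCountingProcess.bddAbove_rate {Ω : Type*} [MeasurableSpace Ω] {N : ℝ≥0 → Ω → ℕ}
    (hN : IsCountingProcess N) (M : Ω → ℝ) (lam : ℕ → ℝ → ℝ) (t hbar : ℝ≥0) (ω : Ω) :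
    BddAbove (Set.range fun s : Set.Icc t (t + hbar) => lam (N s ω) (M ω)) := by
  refine (((Set.finite_Iic (N (t + hbar) ω)).image fun k => lam k (M ω)).subset ?_).bddAbove
  rintro _ ⟨s, rfl⟩
  exact ⟨N s ω, hN.monotone ω s.2.2, rfl⟩

theorem IsCountingProcess.rate_le_rateBound {Ω : Type*} [MeasurableSpace Ω] {N : ℝ≥0 → Ω → ℕ}
    (hN : IsCountingProcess N) (M : Ω → ℝ) (lam : ℕ → ℝ → ℝ) (t : ℝ≥0) {s hbar : ℝ≥0}
    (hs : s ≤ hbar) (ω : Ω) : lam (N (t + s) ω) (M ω) ≤ rateBound N M lam t hbar ω :=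
  le_ciSup (hN.bddAbove_rate M lam t hbar ω) ⟨t + s, le_self_add, by gcongr⟩

theorem sum_range_two_mul_add_one (d : ℕ) :
    ∑ k ∈ Finset.range d, (2 * (k : ℝ≥0∞) + 1) = (d : ℝ≥0∞) ^ 2 := by
  induction d with
  | zero => simp
  | succ d ih => rw [Finset.sum_range_succ, ih]; push_cast; ring

/-- Cutting the weights at `K` truncates the increment, which makes its second moment finite a
priori. -/
theorem sum_range_truncated (d K : ℕ) :
    ∑ k ∈ Finset.range d, (if k < K then 2 * (k : ℝ≥0∞) + 1 else 0) =
      ((min d K : ℕ) : ℝ≥0∞) ^ 2 := by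
  rw [← sum_range_two_mul_add_one, ← Finset.sum_filter]
  congr 1
  ext k
  simp

/-- The inequality `2Dy ≤ D² + y²` separates increment from rate, so no mixed moment has to be
controlled. -/
theorem two_mul_add_one_mul_le {d D : ℕ} (hd : d ≤ D) {x y : ℝ} (hxy : x ≤ y) :
    (2 * (d : ℝ≥0∞) + 1) * ENNReal.ofReal x ≤
      (D : ℝ≥0∞) ^ 2 + (ENNReal.ofReal y ^ 2 + ENNReal.ofReal y) := by
  have h1 : 2 * (D : ℝ≥0) * y.toNNReal ≤ (D : ℝ≥0) ^ 2 + y.toNNReal ^ 2 :=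
    two_mul_le_add_sq _ _
  have h2 : 2 * (D : ℝ≥0∞) * ENNReal.ofReal y ≤ (D : ℝ≥0∞) ^ 2 + ENNReal.ofReal y ^ 2 := by
    rw [ENNReal.ofReal]
    exact_mod_cast h1
  calc (2 * (d : ℝ≥0∞) + 1) * ENNReal.ofReal x
      ≤ (2 * (D : ℝ≥0∞) + 1) * ENNReal.ofReal y := by gcongr
    _ = 2 * (D : ℝ≥0∞) * ENNReal.ofReal y + ENNReal.ofReal y := by ring
    _ ≤ (D : ℝ≥0∞) ^ 2 + ENNReal.ofReal y ^ 2 + ENNReal.ofReal y := by gcongr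
    _ = _ := by ring

/-! ### Infinitesimal mean and variance. -/

namespace IsMixedSimpleMCP

variable {Ω : Type*} [MeasurableSpace Ω] {μ : Measure Ω}
  {N : ℝ≥0 → Ω → ℕ} {M : Ω → ℝ} {p : ℝ → ℝ≥0 → ℕ → ℕ → ℝ} {q : ℝ → ℕ → ℕ → ℝ}
  {lam : ℕ → ℝ → ℝ}

theorem weightedRate_eq_initial (hN : IsMixedSimpleMCP μ N M p q lam) {t : ℝ≥0} {n : ℕ}
    (w : ℕ → ℝ≥0∞) {ω : Ω} (hω : N t ω = n) : ∃ ε : ℝ, 0 < ε ∧ ∀ s ∈ Set.Ioc 0 ε,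
      weightedRate N M lam t n w ω s = w 0 * ENNReal.ofReal (lam n (M ω)) := by
  have h1 := hN.countingProcess.eventually_eq ω t
  have h2 : Tendsto (fun s : ℝ => t + s.toNNReal) (𝓝[>] 0) (𝓝[≥] t) := by
    refine tendsto_nhdsWithin_iff.2 ⟨?_, Eventually.of_forall fun s => Set.mem_Ici.2 le_self_add⟩
    have : Continuous fun s : ℝ => t + s.toNNReal := by fun_prop
    exact (this.tendsto' 0 t (by simp)).mono_left nhdsWithin_le_nhds
  obtain ⟨ε, hε, hsub⟩ := (mem_nhdsGT_iff_exists_Ioc_subset (a := (0 : ℝ))).1 (h2.eventually h1)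
  refine ⟨ε, hε, fun s hs => ?_⟩
  have : N (t + s.toNNReal) ω = n := (hsub hs).trans hω
  simp [weightedRate, this]

theorem measurable_increment (hN : IsMixedSimpleMCP μ N M p q lam) (t h : ℝ≥0) :
    Measurable (increment N t h) :=
  ((measurable_of_countable fun k : ℕ => (k : ℝ)).comp (hN.countingProcess.measurable _)).sub
    ((measurable_of_countable fun k : ℕ => (k : ℝ)).comp (hN.countingProcess.measurable _))

theorem increment_eq_natCast (hN : IsMixedSimpleMCP μ N M p q lam) {t : ℝ≥0} (h : ℝ≥0) {n : ℕ}
    {ω : Ω} (hω : N t ω = n) : increment N t h ω = ((N (t + h) ω - n : ℕ) : ℝ) := by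
  have hle : n ≤ N (t + h) ω := hω ▸ hN.countingProcess.monotone ω le_self_add
  rw [increment, hω, Nat.cast_sub hle]

theorem tendsto_lintegral_weightedRate (hN : IsMixedSimpleMCP μ N M p q lam) {t h₀ : ℝ≥0}
    (hh₀ : 0 < h₀) {n : ℕ} {w : ℕ → ℝ≥0∞} {G : Ω → ℝ≥0∞}
    (hG : ∫⁻ ω, G ω ∂μ[|N t ⁻¹' {n}] ≠ ∞)
    (hdom : ∀ᵐ ω ∂μ[|N t ⁻¹' {n}], ∀ s ∈ Set.Ioc (0 : ℝ) h₀,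
      weightedRate N M lam t n w ω s ≤ G ω) :
    Tendsto (fun h : ℝ≥0 => (h : ℝ≥0∞)⁻¹ * ∫⁻ ω, (∫⁻ s in Set.Ioc (0 : ℝ) h,
      weightedRate N M lam t n w ω s) ∂μ[|N t ⁻¹' {n}]) (𝓝[>] 0)
      (𝓝 (∫⁻ ω, w 0 * ENNReal.ofReal (lam n (M ω)) ∂μ[|N t ⁻¹' {n}])) := by
  have hm := fun h : ℝ≥0 => (hN.measurable_weightedRate t n w).lintegral_prod_right'
    (ν := volume.restrict (Set.Ioc (0 : ℝ) h))
  suffices Tendsto (fun h : ℝ≥0 => ∫⁻ ω, ((h : ℝ≥0∞)⁻¹ * ∫⁻ s in Set.Ioc (0 : ℝ) h,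
      weightedRate N M lam t n w ω s) ∂μ[|N t ⁻¹' {n}]) (𝓝[>] 0)
      (𝓝 (∫⁻ ω, w 0 * ENNReal.ofReal (lam n (M ω)) ∂μ[|N t ⁻¹' {n}])) from
    this.congr fun h => lintegral_const_mul _ (hm h)
  have hcancel : ∀ (h : ℝ≥0), 0 < h → ∀ c : ℝ≥0∞,
      (h : ℝ≥0∞)⁻¹ * (c * volume (Set.Ioc (0 : ℝ) h)) = c := fun h hh c => by
    rw [Real.volume_Ioc, sub_zero, ENNReal.ofReal_coe_nnreal, mul_comm c, ← mul_assoc,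
      ENNReal.inv_mul_cancel (by simpa using hh.ne') ENNReal.coe_ne_top, one_mul]
  have hlt : ∀ᶠ h : ℝ≥0 in 𝓝[>] 0, h ∈ Set.Ioc 0 h₀ := Ioc_mem_nhdsGT hh₀
  refine tendsto_lintegral_filter_of_dominated_convergence G
    (Eventually.of_forall fun h => (hm h).const_mul _) ?_ hG ?_
  · filter_upwards [hlt] with h hh
    filter_upwards [hdom] with ω hω
    calc (h : ℝ≥0∞)⁻¹ * ∫⁻ s in Set.Ioc (0 : ℝ) h, weightedRate N M lam t n w ω s
        ≤ (h : ℝ≥0∞)⁻¹ * ∫⁻ s in Set.Ioc (0 : ℝ) h, G ω := by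
          gcongr 1
          exact setLIntegral_mono measurable_const fun s hs =>
            hω s ⟨hs.1, hs.2.trans (NNReal.coe_le_coe.2 hh.2)⟩
      _ = G ω := by rw [setLIntegral_const, hcancel h hh.1]
  · filter_upwards [ae_cond_mem (hN.measurableSet_state t n)] with ω hω
    obtain ⟨ε, hε, hεs⟩ := hN.weightedRate_eq_initial w hω
    refine tendsto_const_nhds.congr' ?_
    have hlt' : ∀ᶠ h : ℝ≥0 in 𝓝[>] 0, h ∈ Set.Ioc 0 ε.toNNReal :=
      Ioc_mem_nhdsGT (Real.toNNReal_pos.2 hε)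
    filter_upwards [hlt'] with h hh
    have hle : (h : ℝ) ≤ ε := (Real.le_toNNReal_iff_coe_le hε.le).1 hh.2
    rw [setLIntegral_congr_fun measurableSet_Ioc fun s hs =>
      hεs s ⟨hs.1, hs.2.trans hle⟩, setLIntegral_const, hcancel h hh.1]

variable [IsProbabilityMeasure μ]

/-- Infinitesimal expectation of a function of the increment. -/
theorem tendsto_integral_div (hN : IsMixedSimpleMCP μ N M p q lam) {t h₀ : ℝ≥0}
    (hh₀ : 0 < h₀) {n : ℕ} (hA : μ (N t ⁻¹' {n}) ≠ 0) {w : ℕ → ℝ≥0∞} (hw : w 0 = 1)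
    {G : Ω → ℝ≥0∞} (hG : ∫⁻ ω, G ω ∂μ[|N t ⁻¹' {n}] ≠ ∞)
    (hdom : ∀ᵐ ω ∂μ[|N t ⁻¹' {n}], ∀ s ∈ Set.Ioc (0 : ℝ) h₀,
      weightedRate N M lam t n w ω s ≤ G ω)
    {X : ℝ≥0 → Ω → ℝ} (hX : ∀ h, Measurable (X h))
    (hX0 : ∀ h, ∀ᵐ ω ∂μ[|N t ⁻¹' {n}], 0 ≤ X h ω)
    (hXw : ∀ h, ∀ᵐ ω ∂μ[|N t ⁻¹' {n}],
      ENNReal.ofReal (X h ω) = ∑ k ∈ Finset.range (N (t + h) ω - n), w k) :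
    Integrable (fun ω => lam n (M ω)) μ[|N t ⁻¹' {n}] ∧
    (∀ᶠ h in 𝓝[>] (0 : ℝ≥0), Integrable (X h) μ[|N t ⁻¹' {n}]) ∧
    Tendsto (fun h : ℝ≥0 => (∫ ω, X h ω ∂μ[|N t ⁻¹' {n}]) / (h : ℝ)) (𝓝[>] 0)
      (𝓝 (averageRate μ N M lam t n)) := by
  have hlam : Measurable fun ω => lam n (M ω) := (hN.measurable_rate n).comp hN.measurable_mixing
  have hlam0 : ∀ᵐ ω ∂μ[|N t ⁻¹' {n}], 0 ≤ lam n (M ω) :=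
    (hN.ae_cond_transition t n).mono fun ω hω => hω.2.1.rate_nonneg n
  -- The bound `G` also dominates `lam n M`, which is the value of the weighted rate at small
  -- positive times.
  have hfin : ∫⁻ ω, ENNReal.ofReal (lam n (M ω)) ∂μ[|N t ⁻¹' {n}] ≠ ∞ := by
    refine ne_top_of_le_ne_top hG (lintegral_mono_ae ?_)
    filter_upwards [hdom, ae_cond_mem (hN.measurableSet_state t n)] with ω hω hmem
    obtain ⟨ε, hε, hεs⟩ := hN.weightedRate_eq_initial (lam := lam) w hmem
    have hpos : (0 : ℝ) < min ε h₀ := lt_min hε (NNReal.coe_pos.2 hh₀)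
    have h1 := hεs _ ⟨hpos, min_le_left _ _⟩
    rw [hw, one_mul] at h1
    exact h1 ▸ hω _ ⟨hpos, min_le_right _ _⟩
  have hlim := hN.tendsto_lintegral_weightedRate hh₀ hG hdom
  simp only [hw, one_mul, ← hN.lintegral_sum_weight t _ n hA w] at hlim
  have hXl : ∀ h, ∫⁻ ω, ENNReal.ofReal (X h ω) ∂μ[|N t ⁻¹' {n}] =
      ∫⁻ ω, ∑ k ∈ Finset.range (N (t + h) ω - n), w k ∂μ[|N t ⁻¹' {n}] :=
    fun h => lintegral_congr_ae (hXw h)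
  simp only [← hXl] at hlim
  refine ⟨?_, ?_, ?_⟩
  · exact (lintegral_ofReal_ne_top_iff_integrable hlam.aestronglyMeasurable hlam0).1 hfin
  -- Convergence to a finite limit already excludes infinite means for small `h`.
  · filter_upwards [hlim.eventually_ne hfin, self_mem_nhdsWithin] with h hh hpos
    refine (lintegral_ofReal_ne_top_iff_integrable (hX h).aestronglyMeasurable (hX0 h)).1 ?_
    intro htop
    rw [htop, ENNReal.mul_top (by simp)] at hh
    exact hh rfl
  · have := (ENNReal.tendsto_toReal hfin).comp hlim
    rw [averageRate, integral_eq_lintegral_of_nonneg_ae hlam0 hlam.aestronglyMeasurable]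
    refine this.congr fun h => ?_
    rw [integral_eq_lintegral_of_nonneg_ae (hX0 h) (hX h).aestronglyMeasurable,
      Function.comp_apply, ENNReal.toReal_mul, ENNReal.toReal_inv, ENNReal.coe_toReal,
      div_eq_inv_mul]

theorem infinitesimalMean (hN : IsMixedSimpleMCP μ N M p q lam) {t : ℝ≥0} {n : ℕ}
    (hA : μ (N t ⁻¹' {n}) ≠ 0) (hP : PropertyP1 μ N M lam t n) :
    Integrable (fun ω => lam n (M ω)) μ[|N t ⁻¹' {n}] ∧
      HasInfinitesimalMean μ N t n (averageRate μ N M lam t n) := by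
  obtain ⟨hbar, hpos, hint⟩ := hP
  have hmem := ae_cond_mem (μ := μ) (hN.measurableSet_state t n)
  refine hN.tendsto_integral_div hpos hA (w := fun _ => 1) rfl
    (G := fun ω => ENNReal.ofReal (rateBound N M lam t hbar ω)) ?_ ?_
    (hN.measurable_increment t) (fun h => ?_) fun h => ?_
  · exact hint.lintegral_lt_top.ne
  · refine Eventually.of_forall fun ω s hs => ?_
    rw [weightedRate, one_mul]
    exact ENNReal.ofReal_le_ofReal
      (hN.countingProcess.rate_le_rateBound M lam t (Real.toNNReal_le_iff_le_coe.2 hs.2) ω)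
  · filter_upwards [hmem] with ω hω
    rw [hN.increment_eq_natCast h hω]
    positivity
  · filter_upwards [hmem] with ω hω
    rw [hN.increment_eq_natCast h hω]
    simp

/-- A bound for the second moment of the increment over a short time interval. -/
theorem lintegral_sq_increment_le (hN : IsMixedSimpleMCP μ N M p q lam) {t h hbar : ℝ≥0} {n : ℕ}
    (hA : μ (N t ⁻¹' {n}) ≠ 0) (hh : h ≤ hbar) (hh2 : h ≤ 1 / 2) :
    ∫⁻ ω, ((N (t + h) ω - n : ℕ) : ℝ≥0∞) ^ 2 ∂μ[|N t ⁻¹' {n}] ≤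
      2 * ∫⁻ ω, (ENNReal.ofReal (rateBound N M lam t hbar ω) ^ 2 +
        ENNReal.ofReal (rateBound N M lam t hbar ω)) ∂μ[|N t ⁻¹' {n}] := by
  have : IsProbabilityMeasure μ[|N t ⁻¹' {n}] := cond_isProbabilityMeasure hA
  set C := ∫⁻ ω, (ENNReal.ofReal (rateBound N M lam t hbar ω) ^ 2 +
        ENNReal.ofReal (rateBound N M lam t hbar ω)) ∂μ[|N t ⁻¹' {n}] with hC
  have hD : Measurable fun ω => N (t + h) ω := hN.countingProcess.measurable _
  have hDK : ∀ K : ℕ, Measurable fun ω => ((min (N (t + h) ω - n) K : ℕ) : ℝ≥0∞) ^ 2 := fun K =>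
    (measurable_of_countable fun k : ℕ => ((min (k - n) K : ℕ) : ℝ≥0∞) ^ 2).comp hD
  -- With the increment truncated at `K`, Dynkin's formula gives `x ≤ h * (x + C)`; for `h ≤ 1/2`
  -- and finite `x`, the term in `x` is absorbed. The bound is uniform in `K`, so monotone
  -- convergence removes the truncation.
  have key : ∀ K : ℕ,
      ∫⁻ ω, ((min (N (t + h) ω - n) K : ℕ) : ℝ≥0∞) ^ 2 ∂μ[|N t ⁻¹' {n}] ≤ 2 * C := by
    intro K
    set x := ∫⁻ ω, ((min (N (t + h) ω - n) K : ℕ) : ℝ≥0∞) ^ 2 ∂μ[|N t ⁻¹' {n}] with hx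
    have hxtop : x ≠ ∞ := by
      refine ne_top_of_le_ne_top (b := (K : ℝ≥0∞) ^ 2) (by finiteness) ?_
      calc x ≤ ∫⁻ ω, (K : ℝ≥0∞) ^ 2 ∂μ[|N t ⁻¹' {n}] := lintegral_mono fun ω => by
            gcongr; exact min_le_right _ _
        _ = (K : ℝ≥0∞) ^ 2 := by simp
    have h1 := hN.lintegral_sum_weight t h n hA
      (fun k => if k < K then 2 * (k : ℝ≥0∞) + 1 else 0)
    simp only [sum_range_truncated] at h1
    have h2 : x ≤ h * (x + C) := by
      rw [hx, hC, ← lintegral_add_left (hDK K), ← lintegral_const_mul' _ _ ENNReal.coe_ne_top, h1]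
      refine lintegral_mono fun ω => ?_
      calc ∫⁻ s in Set.Ioc (0 : ℝ) h, weightedRate N M lam t n
            (fun k => if k < K then 2 * (k : ℝ≥0∞) + 1 else 0) ω s
          ≤ ∫⁻ _ in Set.Ioc (0 : ℝ) h, (((min (N (t + h) ω - n) K : ℕ) : ℝ≥0∞) ^ 2 +
            (ENNReal.ofReal (rateBound N M lam t hbar ω) ^ 2 +
              ENNReal.ofReal (rateBound N M lam t hbar ω))) := by
            refine setLIntegral_mono measurable_const fun s hs => ?_
            have hsh : s.toNNReal ≤ h := Real.toNNReal_le_iff_le_coe.2 hs.2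
            rw [weightedRate]
            split_ifs with hK
            · refine two_mul_add_one_mul_le (le_min ?_ hK.le)
                (hN.countingProcess.rate_le_rateBound M lam t (hsh.trans hh) ω)
              exact Nat.sub_le_sub_right (hN.countingProcess.monotone ω (by gcongr)) n
            · simp
        _ = _ := by
            rw [setLIntegral_const, Real.volume_Ioc, sub_zero, ENNReal.ofReal_coe_nnreal, mul_comm]
    have hhalf : (h : ℝ≥0∞) ≤ 2⁻¹ := by
      have : (h : ℝ≥0∞) ≤ ((1 / 2 : ℝ≥0) : ℝ≥0∞) := ENNReal.coe_le_coe.2 hh2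
      simpa using this
    have h3 : x ≤ 2⁻¹ * (x + C) := h2.trans (by gcongr)
    have h4 : x + x ≤ x + C := by
      calc x + x = 2 * x := (two_mul x).symm
        _ ≤ 2 * (2⁻¹ * (x + C)) := by gcongr
        _ = x + C := by
          rw [← mul_assoc, ENNReal.mul_inv_cancel two_ne_zero ENNReal.ofNat_ne_top, one_mul]
    have h5 : x ≤ C := (ENNReal.add_le_add_iff_left hxtop).1 h4
    calc x ≤ C := h5
      _ ≤ 2 * C := le_mul_of_one_le_left (zero_le) one_le_two
  refine le_of_tendsto' (lintegral_tendsto_of_tendsto_of_monotone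
    (fun K => (hDK K).aemeasurable) (ae_of_all _ fun ω K L hKL => ?_)
    (ae_of_all _ fun ω => ?_)) key
  · simp only
    gcongr
  · refine tendsto_const_nhds.congr' ?_
    filter_upwards [eventually_ge_atTop (N (t + h) ω - n)] with K hK
    rw [min_eq_left hK]

theorem infinitesimalVariance (hN : IsMixedSimpleMCP μ N M p q lam) {t : ℝ≥0} {n : ℕ}
    (hA : μ (N t ⁻¹' {n}) ≠ 0) (hP : PropertyP2 μ N M lam t n) :
    HasInfinitesimalVariance μ N t n (averageRate μ N M lam t n) := by
  obtain ⟨hbar, hpos, hint, hvar⟩ := hP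
  have : IsProbabilityMeasure μ[|N t ⁻¹' {n}] := cond_isProbabilityMeasure hA
  have hmem := ae_cond_mem (μ := μ) (hN.measurableSet_state t n)
  have hL2 := (evariance_lt_top_iff_memLp hint.aestronglyMeasurable).1 hvar
  have hsq0 : 0 ≤ᵐ[μ[|N t ⁻¹' {n}]] rateBound N M lam t hbar := by
    filter_upwards [hN.ae_cond_transition t n] with ω hω
    exact (hω.2.1.rate_nonneg _).trans
      (hN.countingProcess.rate_le_rateBound M lam t (zero_le : 0 ≤ hbar) ω)
  have hC : ∫⁻ ω, (ENNReal.ofReal (rateBound N M lam t hbar ω) ^ 2 +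
      ENNReal.ofReal (rateBound N M lam t hbar ω)) ∂μ[|N t ⁻¹' {n}] ≠ ∞ := by
    rw [lintegral_add_right' _ hint.aemeasurable.ennreal_ofReal]
    refine ENNReal.add_ne_top.2 ⟨?_, hint.lintegral_lt_top.ne⟩
    have h1 := hL2.integrable_sq.lintegral_lt_top.ne
    rwa [lintegral_congr_ae (hsq0.mono fun ω hω => ENNReal.ofReal_pow hω 2)] at h1
  -- The weights `2k + 1` add up to the squared increment. The dominating function uses the
  -- increment over the whole window, cut to length at most `1/2` so that its second moment is
  -- finite.
  have hsq := hN.tendsto_integral_div (h₀ := min hbar (1 / 2)) (lt_min hpos (by norm_num)) hA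
    (w := fun k => 2 * (k : ℝ≥0∞) + 1) (by simp)
    (G := fun ω => ((N (t + min hbar (1 / 2)) ω - n : ℕ) : ℝ≥0∞) ^ 2 +
      (ENNReal.ofReal (rateBound N M lam t hbar ω) ^ 2 +
        ENNReal.ofReal (rateBound N M lam t hbar ω)))
    (by
      rw [lintegral_add_left]
      · refine ENNReal.add_ne_top.2 ⟨ne_top_of_le_ne_top (ENNReal.mul_ne_top (by simp) hC)
          (hN.lintegral_sq_increment_le hA (min_le_left _ _) (min_le_right _ _)), hC⟩
      · exact (measurable_of_countable fun k : ℕ => ((k - n : ℕ) : ℝ≥0∞) ^ 2).comp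
          (hN.countingProcess.measurable _))
    (Eventually.of_forall fun ω s hs => by
      have hsh : s.toNNReal ≤ min hbar (1 / 2) := Real.toNNReal_le_iff_le_coe.2 hs.2
      exact two_mul_add_one_mul_le
        (Nat.sub_le_sub_right (hN.countingProcess.monotone ω (by gcongr)) n)
        (hN.countingProcess.rate_le_rateBound M lam t (hsh.trans (min_le_left _ _)) ω))
    (X := fun h ω => increment N t h ω ^ 2) (fun h => (hN.measurable_increment t h).pow_const 2)
    (fun h => ae_of_all _ fun ω => sq_nonneg _)
    (fun h => hmem.mono fun ω hω => by
      rw [hN.increment_eq_natCast h hω, sum_range_two_mul_add_one,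
        ENNReal.ofReal_pow (Nat.cast_nonneg _), ENNReal.ofReal_natCast])
  have hL : ∀ᶠ h in 𝓝[>] (0 : ℝ≥0), MemLp (increment N t h) 2 μ[|N t ⁻¹' {n}] :=
    hsq.2.1.mono fun h hh =>
      (memLp_two_iff_integrable_sq (hN.measurable_increment t h).aestronglyMeasurable).2 hh
  refine ⟨hL, ?_⟩
  have hmean := (hN.infinitesimalMean hA ⟨hbar, hpos, hint⟩).2.2
  have h0 : Tendsto (fun h : ℝ≥0 => (h : ℝ)) (𝓝[>] 0) (𝓝 0) :=
    (NNReal.continuous_coe.tendsto' 0 0 rfl).mono_left nhdsWithin_le_nhds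
  -- The variance divided by `h` is the second moment over `h` minus `(mean / h)² * h`.
  have hlim := hsq.2.2.sub ((hmean.pow 2).mul h0)
  rw [mul_zero, sub_zero] at hlim
  refine hlim.congr' ?_
  filter_upwards [hL, self_mem_nhdsWithin] with h hh hh0
  have hne : (h : ℝ) ≠ 0 := (NNReal.coe_pos.2 hh0).ne'
  rw [variance_eq_sub hh]
  simp only [Pi.pow_apply]
  field_simp

theorem equidispersed (hN : IsMixedSimpleMCP μ N M p q lam) {t : ℝ≥0} {n : ℕ}
    (hA : μ (N t ⁻¹' {n}) ≠ 0) (hP : PropertyP2 μ N M lam t n) :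
    IsInfinitesimallyEquidispersedAt μ N t n := by
  refine ⟨_, _, (hN.infinitesimalMean hA (hP.imp fun _ h => ⟨h.1, h.2.1⟩)).2,
    hN.infinitesimalVariance hA hP, ?_⟩
  rcases eq_or_ne (averageRate μ N M lam t n) 0 with h | h
  · exact Or.inr ⟨h, h⟩
  · exact Or.inl (div_self h)

end IsMixedSimpleMCP

/-! ### Mixed Poisson processes: bounds on the rate given the state. -/

namespace IsMCPTransition

variable {p : ℝ≥0 → ℕ → ℕ → ℝ} {q : ℕ → ℕ → ℝ} {lam : ℕ → ℝ} {m : ℝ}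

theorem antitone_transitionCDF (hp : IsMCPTransition p q lam) (i j : ℕ) :
    Antitone (transitionCDF p i j) := by
  intro a b hab
  rw [← sub_nonpos, ← add_tsub_cancel_of_le hab, hp.transitionCDF_add_sub]
  refine Finset.sum_nonpos fun l _ => mul_nonpos_of_nonneg_of_nonpos (hp.nonneg _ _ _) ?_
  exact sub_nonpos.2 (sum_le_hasSum _ (fun k _ => hp.nonneg _ l k) (hp.hasSum_one _ l))

/-- The integrated flux out of each state `l ≤ j` is a probability, so `m` times the mean time spent
at or below `j` is at most `j + 1`. As `transitionCDF` decreases in time, that mean time up to `t`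
is at least `t * transitionCDF p i j t`. -/
theorem rate_mul_time_mul_le (hp : IsMCPTransition p q lam) (hq : IsSimpleJumps q)
    (hlam : ∀ n, lam n = m) (t : ℝ≥0) (i j : ℕ) : m * t * p t i j ≤ j + 1 := by
  have hm : 0 ≤ m := hlam 0 ▸ hp.rate_nonneg 0
  have hcont : ∀ l, Continuous fun s : ℝ => m * p s.toNNReal i l := fun l =>
    continuous_const.mul ((hp.continuous_apply hq i l).comp continuous_real_toNNReal)
  have h1 : ∀ l, ∫ s in (0 : ℝ)..t, m * p s.toNNReal i l ≤ 1 := by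
    intro l
    rcases le_or_gt i l with hil | hil
    · have h := hp.integral_flux hq hil t
      rw [hlam l] at h
      rw [h, sub_le_self_iff]
      exact Finset.sum_nonneg fun k _ => hp.nonneg _ _ _
    · simp [hp.counting _ _ _ hil]
  calc m * t * p t i j ≤ m * t * transitionCDF p i j t := by
        gcongr
        exact Finset.single_le_sum (f := fun l => p t i l) (fun l _ => hp.nonneg t i l)
          (Finset.mem_range.2 (Nat.lt_succ_self j))
    _ = ∫ _ in (0 : ℝ)..t, m * transitionCDF p i j t := by
        rw [intervalIntegral.integral_const, sub_zero, smul_eq_mul]; ring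
    _ ≤ ∫ s in (0 : ℝ)..t, ∑ l ∈ Finset.range (j + 1), m * p s.toNNReal i l := by
        refine intervalIntegral.integral_mono_on t.coe_nonneg
          (continuous_const.intervalIntegrable _ _)
          ((continuous_finsetSum _ fun l _ => hcont l).intervalIntegrable _ _) fun s hs => ?_
        rw [← Finset.mul_sum]
        exact mul_le_mul_of_nonneg_left
          (hp.antitone_transitionCDF i j (Real.toNNReal_le_iff_le_coe.2 hs.2)) hm
    _ = ∑ l ∈ Finset.range (j + 1), ∫ s in (0 : ℝ)..t, m * p s.toNNReal i l :=
        intervalIntegral.integral_finsetSum fun l _ => (hcont l).intervalIntegrable _ _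
    _ ≤ ∑ l ∈ Finset.range (j + 1), (1 : ℝ) := Finset.sum_le_sum fun l _ => h1 l
    _ = j + 1 := by simp

/-- Splitting `[0, t]` at `t / 2` lets each half absorb one factor `m`. There are `j + 1`
intermediate states, each contributing at most `(j + 1)²`, and the `4` comes from `(t / 2)²`. -/
theorem rate_sq_mul_le (hp : IsMCPTransition p q lam) (hq : IsSimpleJumps q)
    (hlam : ∀ n, lam n = m) {t : ℝ≥0} (ht : 0 < t) (i j : ℕ) :
    m ^ 2 * p t i j ≤ 4 * (j + 1) ^ 3 / (t : ℝ) ^ 2 := by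
  have hm : 0 ≤ m := hlam 0 ▸ hp.rate_nonneg 0
  have ht' : 0 < (t : ℝ) := NNReal.coe_pos.2 ht
  have hck := hp.chapman_kolmogorov_sum (t / 2) (t / 2) i (le_refl j)
  rw [add_halves] at hck
  have hb : ∀ a b, m * ((t : ℝ) / 2) * p (t / 2) a b ≤ b + 1 := fun a b => by
    simpa using hp.rate_mul_time_mul_le hq hlam (t / 2) a b
  rw [le_div_iff₀ (by positivity)]
  have key : ∑ l ∈ Finset.range (j + 1), (m * ((t : ℝ) / 2) * p (t / 2) i l) *
      (m * ((t : ℝ) / 2) * p (t / 2) l j) ≤ ∑ l ∈ Finset.range (j + 1), ((j : ℝ) + 1) ^ 2 := by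
    refine Finset.sum_le_sum fun l hl => ?_
    have hlj : (l : ℝ) ≤ j := by exact_mod_cast Nat.lt_succ_iff.1 (Finset.mem_range.1 hl)
    rw [sq]
    refine mul_le_mul ((hb i l).trans (by gcongr)) (hb l j) ?_ (by positivity)
    exact mul_nonneg (by positivity) (hp.nonneg _ _ _)
  rw [Finset.sum_const, Finset.card_range, nsmul_eq_mul] at key
  have h2 : ∑ l ∈ Finset.range (j + 1), (m * ((t : ℝ) / 2) * p (t / 2) i l) *
      (m * ((t : ℝ) / 2) * p (t / 2) l j) = m ^ 2 * p t i j * (t : ℝ) ^ 2 / 4 := by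
    rw [hck, Finset.mul_sum, Finset.sum_mul, Finset.sum_div]
    exact Finset.sum_congr rfl fun l _ => by ring
  rw [h2] at key
  push_cast at key
  nlinarith [key]

end IsMCPTransition

/-! ### Mixed Poisson processes: moments of the mixing variable given the state. -/

namespace IsMixedSimpleMCP

variable {Ω : Type*} [MeasurableSpace Ω] {μ : Measure Ω}
  {N : ℝ≥0 → Ω → ℕ} {M : Ω → ℝ} {p : ℝ → ℝ≥0 → ℕ → ℕ → ℝ} {q : ℝ → ℕ → ℕ → ℝ}
  {lam : ℕ → ℝ → ℝ}

theorem ae_rate_eq_mixing (hN : IsMixedSimpleMCP μ N M p q lam)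
    (hq : ∀ᵐ m ∂(μ.map M), ∀ n, q m n 1 = m) : ∀ᵐ ω ∂μ, ∀ n, lam n (M ω) = M ω := by
  filter_upwards [hN.ae_transition, ae_of_ae_map hN.measurable_mixing.aemeasurable hq]
    with ω hω hqω n
  rw [← hω.1.jump_one_eq_rate hω.2 n, hqω n]

/-- At positive times, the law of the mixing variable of a mixed Poisson process given the state
has a finite second moment. -/
theorem memLp_two_mixing_cond [IsProbabilityMeasure μ] (hN : IsMixedSimpleMCP μ N M p q lam)
    (hlam : ∀ᵐ ω ∂μ, ∀ n, lam n (M ω) = M ω) {t : ℝ≥0} (ht : 0 < t) {n : ℕ}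
    (hA : μ (N t ⁻¹' {n}) ≠ 0) : MemLp M 2 μ[|N t ⁻¹' {n}] := by
  have hsqm : Measurable fun m : ℝ => ENNReal.ofReal (m ^ 2) :=
    (measurable_id.pow_const 2).ennreal_ofReal
  -- The initial state may be random and depend on `M`, so the event is split by its value;
  -- monotonicity leaves only `i ≤ n`.
  have hi : ∀ i, ∫⁻ ω in N 0 ⁻¹' {i} ∩ N t ⁻¹' {n}, ENNReal.ofReal (M ω ^ 2) ∂μ ≠ ∞ := by
    intro i
    have h1 := hN.setLIntegral_state 0 t i n hsqm
    rw [zero_add] at h1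
    rw [h1]
    refine ne_top_of_le_ne_top (b := ∫⁻ _ in N 0 ⁻¹' {i},
      ENNReal.ofReal (4 * (n + 1) ^ 3 / (t : ℝ) ^ 2) ∂μ) ?_ (lintegral_mono_ae ?_)
    · rw [setLIntegral_const]
      exact ENNReal.mul_ne_top ENNReal.ofReal_ne_top (measure_ne_top _ _)
    · refine ae_restrict_of_ae ?_
      filter_upwards [hN.ae_transition, hlam] with ω hω hl
      rw [← ENNReal.ofReal_mul (sq_nonneg _)]
      exact ENNReal.ofReal_le_ofReal (hω.1.rate_sq_mul_le hω.2 hl ht i n)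
  have hcover : N t ⁻¹' {n} ⊆ ⋃ i : Fin (n + 1), N 0 ⁻¹' {(i : ℕ)} ∩ N t ⁻¹' {n} := by
    intro ω hω
    have hle : N 0 ω ≤ N t ω := hN.countingProcess.monotone ω zero_le
    rw [show N t ω = n from hω] at hle
    exact Set.mem_iUnion.2 ⟨⟨N 0 ω, Nat.lt_succ_of_le hle⟩, rfl, hω⟩
  have hfin : ∫⁻ ω in N t ⁻¹' {n}, ENNReal.ofReal (M ω ^ 2) ∂μ ≠ ∞ :=
    ne_top_of_le_ne_top (ENNReal.sum_ne_top.2 fun (i : Fin (n + 1)) _ => hi i)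
      ((lintegral_mono_set hcover).trans ((lintegral_iUnion_le _ _).trans_eq (tsum_fintype _)))
  rw [memLp_two_iff_integrable_sq hN.measurable_mixing.aestronglyMeasurable,
    ← lintegral_ofReal_ne_top_iff_integrable
      (hN.measurable_mixing.pow_const 2).aestronglyMeasurable (ae_of_all _ fun ω => sq_nonneg _),
    ProbabilityTheory.cond, lintegral_smul_measure]
  exact ENNReal.mul_ne_top (ENNReal.inv_ne_top.2 hA) hfin

theorem rateBound_ae_eq_mixing (hlam : ∀ᵐ ω ∂μ, ∀ n, lam n (M ω) = M ω) (t hbar : ℝ≥0) (n : ℕ) :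
    rateBound N M lam t hbar =ᵐ[μ[|N t ⁻¹' {n}]] M := by
  filter_upwards [cond_absolutelyContinuous.ae_le hlam] with ω hω
  have : Nonempty (Set.Icc t (t + hbar)) := ⟨⟨t, le_rfl, le_self_add⟩⟩
  simp only [rateBound, hω, ciSup_const]

end IsMixedSimpleMCP

theorem mainTheorem9 {Ω : Type*} [MeasurableSpace Ω] (μ : Measure Ω) [IsProbabilityMeasure μ]
    (N : ℝ≥0 → Ω → ℕ) (M : Ω → ℝ) (p : ℝ → ℝ≥0 → ℕ → ℕ → ℝ) (q : ℝ → ℕ → ℕ → ℝ)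
    (lam : ℕ → ℝ → ℝ) (hN : IsMixedSimpleMCP μ N M p q lam) :
    -- the general result, at each time `t` and each state `n` that is attained at time `t`
    (∀ (t : ℝ≥0) (n : ℕ), μ (N t ⁻¹' {n}) ≠ 0 →
      (PropertyP1 μ N M lam t n →
        Integrable (fun ω => lam n (M ω)) (μ[|N t ⁻¹' {n}]) ∧
        HasInfinitesimalMean μ N t n (averageRate μ N M lam t n)) ∧
      (PropertyP2 μ N M lam t n →
        HasInfinitesimalVariance μ N t n (averageRate μ N M lam t n) ∧
        IsInfinitesimallyEquidispersedAt μ N t n)) ∧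
    -- the mixed Poisson process with `E[M] < ∞`
    ((∀ᵐ m ∂(μ.map M), ∀ n, q m n 1 = m) → Integrable M μ →
      ∀ (t : ℝ≥0) (n : ℕ), μ (N t ⁻¹' {n}) ≠ 0 →
        HasInfinitesimalMean μ N t n (∫ ω, M ω ∂(μ[|N t ⁻¹' {n}])) ∧
        (0 < t ∨ MemLp M 2 μ →
          HasInfinitesimalVariance μ N t n (∫ ω, M ω ∂(μ[|N t ⁻¹' {n}])) ∧
          IsInfinitesimallyEquidispersedAt μ N t n)) := by
  refine ⟨fun t n hA => ⟨fun hP => hN.infinitesimalMean hA hP, fun hP =>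
    ⟨hN.infinitesimalVariance hA hP, hN.equidispersed hA hP⟩⟩, fun hq hM t n hA => ?_⟩
  have : IsProbabilityMeasure μ[|N t ⁻¹' {n}] := cond_isProbabilityMeasure hA
  have hinv : (μ (N t ⁻¹' {n}))⁻¹ ≠ ∞ := ENNReal.inv_ne_top.2 hA
  have hlam := hN.ae_rate_eq_mixing hq
  have hlam' : ∀ᵐ ω ∂μ[|N t ⁻¹' {n}], ∀ k, lam k (M ω) = M ω :=
    cond_absolutelyContinuous.ae_le hlam
  -- The window length `1` is arbitrary: the rate does not depend on the state, so the supremum is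
  -- `M` for every window.
  have hbound := IsMixedSimpleMCP.rateBound_ae_eq_mixing (N := N) hlam t 1 n
  have havg : averageRate μ N M lam t n = ∫ ω, M ω ∂μ[|N t ⁻¹' {n}] :=
    integral_congr_ae (hlam'.mono fun ω hω => hω n)
  have hMν : Integrable M μ[|N t ⁻¹' {n}] := hM.restrict.smul_measure hinv
  have hint := hMν.congr hbound.symm
  rw [← havg]
  refine ⟨(hN.infinitesimalMean hA ⟨1, one_pos, hint⟩).2, fun h => ?_⟩
  have hM2 : MemLp M 2 μ[|N t ⁻¹' {n}] := h.elim (fun ht => hN.memLp_two_mixing_cond hlam ht hA)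
    fun h2 => (h2.restrict _).smul_measure hinv
  have hP : PropertyP2 μ N M lam t n :=
    ⟨1, one_pos, hint, evariance_lt_top ((memLp_congr_ae hbound).2 hM2)⟩
  exact ⟨hN.infinitesimalVariance hA hP, hN.equidispersed hA hP⟩
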